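/- Let $d\ge 1$ and let $G\le \operatorname{O}(d)$ be a finite group of order $m$, acting on $\mathbb{R}^d$ (with its Euclidean inner product and norm). Write $[x]=G\cdot x$ for the orbit of $x\in\mathbb{R}^d$, and equip the orbit space $\mathbb{R}^d/G$ with the quotient metric $$d([x],[y])=\inf_{p\in[x],\,q\in[y]}\|p-q\|$$ and the max filtering map $$\langle\langle [x],[y]\rangle\rangle=\sup_{p\in[x],\,q\in[y]}\langle p,q\rangle .$$ For templates $z_1,\dots,z_n\in\mathbb{R}^d$, the corresponding max filter bank is the map $\Phi\colon\mathbb{R}^d/G\to\mathbb{R}^n$ given by $\Phi([x])=(\langle\langle [z_i],[x]\rangle\rangle)_{i=1}^n$. Put $$\delta:=\Big(\frac{\pi}{128m^4}\cdot\frac{1}{2d+3\log(4m^2)}\Big)^{1/2},$$ and let $n$ be an integer with $$n\ \ge\ 12\,m^2d\,\log\!\Big(\frac{2}{\delta}+1\Big),$$ where $\log$ is the natural logarithm. Let $z_1,\dots,z_n$ be independent random vectors, each uniformly distributed on the unit sphere $S^{d-1}\subset\mathbb{R}^d$. Then, with probability at least $1-e^{-n/(12m^2)}$, the max filter bank $\Phi$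 with templates $z_1,\dots,z_n$ has lower Lipschitz bound $\delta$ and upper Lipschitz bound $n^{1/2}$, that is, $$\delta\, d([x],[y])\ \le\ \|\Phi([x])-\Phi([y])\|\ \le\ n^{1/2}\, d([x],[y])\qquad\text{for all } x,y\in\mathbb{R}^d,$$ where $\|\cdot\|$ is the Euclidean norm. -/

import Mathlib

open MeasureTheory ProbabilityTheory

noncomputable section

namespace MaxFiltering

variable {V : Type*} [NormedAddCommGroup V] [InnerProductSpace ℝ V]

/-- The orbit equivalence relation on `V` of a group `G` of linear isometries of `V`. -/
def orbitSetoid (G : Subgroup (V ≃ₗᵢ[ℝ] V)) : Setoid V where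
  r x y := ∃ g ∈ G, g x = y
  iseqv :=
    { refl := fun x => ⟨1, G.one_mem, rfl⟩
      symm := by
        rintro x y ⟨g, hg, rfl⟩
        exact ⟨g⁻¹, G.inv_mem hg, g.symm_apply_apply x⟩
      trans := by
        rintro x y z ⟨g, hg, rfl⟩ ⟨h, hh, rfl⟩
        exact ⟨h * g, G.mul_mem hh hg, rfl⟩ }

/-- The quotient space `V / G` of `G`-orbits. -/
def OrbitSpace (G : Subgroup (V ≃ₗᵢ[ℝ] V)) : Type _ :=
  Quotient (orbitSetoid G)

/-- The orbit `[x]` of a vector `x`. -/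
def orbitMk (G : Subgroup (V ≃ₗᵢ[ℝ] V)) (x : V) : OrbitSpace G :=
  Quotient.mk (orbitSetoid G) x

/-- The quotient metric `d(a, b) = inf {‖p - q‖ : p ∈ a, q ∈ b}` on `V / G`. -/
def quotientDist (G : Subgroup (V ≃ₗᵢ[ℝ] V)) (a b : OrbitSpace G) : ℝ :=
  sInf {r : ℝ | ∃ p q : V, orbitMk G p = a ∧ orbitMk G q = b ∧ r = ‖p - q‖}

/-- The max filtering map `⟪⟪a, b⟫⟫ = sup {⟪p, q⟫ : p ∈ a, q ∈ b}` on `V / G`.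
The set is nonempty, and it is bounded above because `G` acts by isometries. -/
def maxFilter (G : Subgroup (V ≃ₗᵢ[ℝ] V)) (a b : OrbitSpace G) : ℝ :=
  sSup {r : ℝ | ∃ p q : V, orbitMk G p = a ∧ orbitMk G q = b ∧ r = inner ℝ p q}

/-- The max filter bank `Φ : V / G → ℝ^n` with templates `z₁, …, zₙ`,
where `ℝ^n` carries the Euclidean norm. -/
def maxFilterBank (G : Subgroup (V ≃ₗᵢ[ℝ] V)) {n : ℕ} (z : Fin n → V) (a : OrbitSpace G) :
    EuclideanSpace ℝ (Fin n) :=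
  WithLp.toLp 2 (fun i => maxFilter G (orbitMk G (z i)) a)

/-- `c` is a lower Lipschitz bound of `Φ : V / G → ℝ^n` for the quotient metric. -/
def HasLowerLipschitzBound (G : Subgroup (V ≃ₗᵢ[ℝ] V)) {n : ℕ}
    (Φ : OrbitSpace G → EuclideanSpace ℝ (Fin n)) (c : ℝ) : Prop :=
  ∀ a b : OrbitSpace G, c * quotientDist G a b ≤ ‖Φ a - Φ b‖

/-- `C` is an upper Lipschitz bound of `Φ : V / G → ℝ^n` for the quotient metric. -/
def HasUpperLipschitzBound (G : Subgroup (V ≃ₗᵢ[ℝ] V)) {n : ℕ}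
    (Φ : OrbitSpace G → EuclideanSpace ℝ (Fin n)) (C : ℝ) : Prop :=
  ∀ a b : OrbitSpace G, ‖Φ a - Φ b‖ ≤ C * quotientDist G a b

/-- The uniform distribution on the unit sphere of `ℝ^d`: the surface measure
normalised to have total mass one (a probability measure when `0 < d`). -/
def unifSphere (d : ℕ) : Measure (Metric.sphere (0 : EuclideanSpace ℝ (Fin d)) 1) :=
  ((volume : Measure (EuclideanSpace ℝ (Fin d))).toSphere Set.univ)⁻¹ •
    (volume : Measure (EuclideanSpace ℝ (Fin d))).toSphere

end MaxFiltering

end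

/-! The upper bound holds for all unit templates, since each coordinate of the filter bank is then
1-Lipschitz. For the lower bound, fix x and y. Each template attains its two maxima at some pair of
group elements; there are m² pairs, so some pair (g₀, k₀) serves at least n/m² templates. For these,
the coordinate difference is the inner product of z_i with w = g₀x - k₀y, and ‖w‖ is at least the
quotient distance. Hence one template in this class that is not δ-nearly orthogonal to w suffices
(`hasLowerLipschitzBound_maxFilterBank`).

It remains to show that, with high probability, no unit vector is δ-nearly orthogonal to n/m² or
more templates (`measureReal_exists_card_slab_ge_le`). A δ-net reduces this to finitely many
directions, with slabs widened to 2δ. The choice of δ makes each slab have mass at most 1/(4m²)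
(`unifSphere_slab_le`), a Chernoff bound controls one direction, and the hypothesis on n pays for
the union bound. -/

namespace MaxFiltering

/-! ### Mass of slabs on the sphere -/

theorem volume_ball_euclideanSpace_fin (k : ℕ) :
    volume (Metric.ball (0 : EuclideanSpace ℝ (Fin k)) 1) =
      ENNReal.ofReal (√Real.pi ^ k / Real.Gamma (k / 2 + 1)) := by
  rcases Nat.eq_zero_or_pos k with rfl | hk
  · have h : Metric.ball (0 : EuclideanSpace ℝ (Fin 0)) 1 =
        (MeasurableEquiv.toLp 2 (Fin 0 → ℝ)).symm ⁻¹' Set.univ := by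
      ext x
      simp [Subsingleton.elim x 0]
    rw [h, (EuclideanSpace.volume_preserving_symm_measurableEquiv_toLp (Fin 0)).measure_preimage
      MeasurableSet.univ.nullMeasurableSet]
    simp [volume_pi]
  · have : Nonempty (Fin k) := Fin.pos_iff_nonempty.mp hk
    rw [EuclideanSpace.volume_ball]
    simp

/-- In orthonormal coordinates starting with u, the set lies in the product of an interval of length
2s and a unit ball of one dimension less. -/
theorem volume_slab_inter_ball_le {k : ℕ} (u : EuclideanSpace ℝ (Fin (k + 1))) (hu : ‖u‖ = 1)
    (s : ℝ) :
    volume {x : EuclideanSpace ℝ (Fin (k + 1)) | ‖x‖ < 1 ∧ |inner ℝ x u| < s} ≤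
      ENNReal.ofReal (2 * s) * volume (Metric.ball (0 : EuclideanSpace ℝ (Fin k)) 1) := by
  obtain ⟨b, hb⟩ := Orthonormal.exists_orthonormalBasis_extension_of_card_eq (𝕜 := ℝ)
    (E := EuclideanSpace ℝ (Fin (k + 1))) (ι := Fin (k + 1)) (by simp)
    (v := fun _ => u) (s := {0}) (by
      constructor
      · intro i; simpa using hu
      · intro i j hij
        exact absurd (Subsingleton.elim i j) hij)
  have hb0 : b 0 = u := hb 0 rfl
  have h1 := b.measurePreserving_repr
  have h2 := EuclideanSpace.volume_preserving_symm_measurableEquiv_toLp (Fin (k + 1))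
  have h3 := volume_preserving_piFinSuccAbove (fun _ : Fin (k + 1) => ℝ) 0
  have h4 := EuclideanSpace.volume_preserving_symm_measurableEquiv_toLp (Fin k)
  have h := (h3.comp h2).comp h1
  set B : Set (Fin k → ℝ) := {w | ∑ i, w i ^ 2 < 1} with hB
  have hBm : MeasurableSet B := by
    apply measurableSet_lt <;> fun_prop
  have hBv : volume B = volume (Metric.ball (0 : EuclideanSpace ℝ (Fin k)) 1) := by
    rw [← h4.measure_preimage hBm.nullMeasurableSet]
    congr 1
    ext x
    simp only [hB, Set.mem_preimage, Set.mem_ofPred_eq, Metric.mem_ball, dist_zero_right,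
      EuclideanSpace.norm_eq, Real.norm_eq_abs, sq_abs]
    rw [Real.sqrt_lt' one_pos]
    simp
  have hS : MeasurableSet (Set.Ioo (-s) s ×ˢ B) := measurableSet_Ioo.prod hBm
  calc _ ≤ volume ((((MeasurableEquiv.piFinSuccAbove (fun _ : Fin (k + 1) => ℝ) 0) ∘
        (MeasurableEquiv.toLp 2 (Fin (k + 1) → ℝ)).symm) ∘ b.repr) ⁻¹' (Set.Ioo (-s) s ×ˢ B)) := by
        apply measure_mono
        rintro x ⟨hx1, hx2⟩
        have e0 : b.repr x 0 = inner ℝ x u := by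
          rw [b.repr_apply_apply, hb0, real_inner_comm]
        have hn : ∑ i, (b.repr x i) ^ 2 < 1 := by
          rw [← b.repr.norm_map, EuclideanSpace.norm_eq, Real.sqrt_lt' one_pos] at hx1
          simpa using hx1
        rw [Fin.sum_univ_succ] at hn
        refine ⟨?_, ?_⟩
        · change b.repr x 0 ∈ Set.Ioo (-s) s
          rw [e0]
          exact abs_lt.mp hx2
        · change ∑ i, (b.repr x ((0 : Fin (k + 1)).succAbove i)) ^ 2 < 1
          simp only [Fin.zero_succAbove]
          nlinarith [sq_nonneg (b.repr x 0)]
    _ = volume (Set.Ioo (-s) s ×ˢ B) := h.measure_preimage hS.nullMeasurableSet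
    _ = _ := by
        rw [Measure.volume_eq_prod, Measure.prod_prod, Real.volume_Ioo, hBv]
        congr 2
        ring

/-- Log-convexity of Γ at the midpoint of x and x + 1. -/
theorem Gamma_add_half_le {x : ℝ} (hx : 0 < x) :
    Real.Gamma (x + 1 / 2) ≤ √x * Real.Gamma x := by
  have h := Real.Gamma_mul_add_mul_le_rpow_Gamma_mul_rpow_Gamma hx (add_pos hx one_pos)
    (a := 1 / 2) (b := 1 / 2) (by norm_num) (by norm_num) (by norm_num)
  have hG := Real.Gamma_pos_of_pos hx
  rw [Real.Gamma_add_one hx.ne', ← Real.sqrt_eq_rpow, ← Real.sqrt_eq_rpow,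
    Real.sqrt_mul hx.le] at h
  calc _ = Real.Gamma (1 / 2 * x + 1 / 2 * (x + 1)) := by congr 1; ring
    _ ≤ _ := h
    _ = √x * (√(Real.Gamma x) * √(Real.Gamma x)) := by ring
    _ = _ := by rw [Real.mul_self_sqrt hG.le]

theorem volume_ball_le_volume_ball_succ (k : ℕ) :
    volume (Metric.ball (0 : EuclideanSpace ℝ (Fin k)) 1) ≤
      ENNReal.ofReal (√((k + 1 : ℕ) / Real.pi)) *
        volume (Metric.ball (0 : EuclideanSpace ℝ (Fin (k + 1))) 1) := by
  rw [volume_ball_euclideanSpace_fin, volume_ball_euclideanSpace_fin,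
    ← ENNReal.ofReal_mul (Real.sqrt_nonneg _)]
  apply ENNReal.ofReal_le_ofReal
  have hx : (0 : ℝ) < k / 2 + 1 := by positivity
  have hG := Gamma_add_half_le hx
  have hG0 := Real.Gamma_pos_of_pos hx
  have hG1 : 0 < Real.Gamma (((k + 1 : ℕ) : ℝ) / 2 + 1) := Real.Gamma_pos_of_pos (by positivity)
  have hle : √((k : ℝ) / 2 + 1) ≤ √((k + 1 : ℕ) : ℝ) := by
    apply Real.sqrt_le_sqrt
    push_cast
    have : (0 : ℝ) ≤ k := by positivity
    linarith
  have e : ((k + 1 : ℕ) : ℝ) / 2 + 1 = k / 2 + 1 + 1 / 2 := by push_cast; ring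
  rw [e] at hG1 ⊢
  have hpi : 0 < √Real.pi := Real.sqrt_pos.mpr Real.pi_pos
  rw [Real.sqrt_div (by positivity), pow_succ]
  have : √((k + 1 : ℕ) : ℝ) / √Real.pi *
      (√Real.pi ^ k * √Real.pi / Real.Gamma (k / 2 + 1 + 1 / 2)) =
      √((k + 1 : ℕ) : ℝ) * √Real.pi ^ k / Real.Gamma (k / 2 + 1 + 1 / 2) := by
    field_simp
  rw [this, div_le_div_iff₀ hG0 hG1]
  calc _ ≤ √Real.pi ^ k * (√((k + 1 : ℕ) : ℝ) * Real.Gamma (k / 2 + 1)) := by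
        gcongr
        exact hG.trans (by gcongr)
    _ = _ := by ring

theorem measurableSet_sphere_slab {d : ℕ} (u : EuclideanSpace ℝ (Fin d)) (s : ℝ) :
    MeasurableSet {z : Metric.sphere (0 : EuclideanSpace ℝ (Fin d)) 1 |
      |inner ℝ (z : EuclideanSpace ℝ (Fin d)) u| < s} :=
  measurableSet_lt (Continuous.measurable (by fun_prop)) measurable_const

/-- A slab of half-width `s` has small mass for the uniform distribution on the sphere. -/
theorem unifSphere_slab_le {d : ℕ} (hd : 0 < d) (u : EuclideanSpace ℝ (Fin d)) (hu : ‖u‖ = 1)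
    {s : ℝ} (hs : 0 ≤ s) :
    unifSphere d {z | |inner ℝ (z : EuclideanSpace ℝ (Fin d)) u| < s} ≤
      ENNReal.ofReal (2 * s * √(d / Real.pi)) := by
  obtain ⟨k, rfl⟩ : ∃ k, d = k + 1 := ⟨d - 1, by omega⟩
  set vd := volume (Metric.ball (0 : EuclideanSpace ℝ (Fin (k + 1))) 1)
  have hvd0 : vd ≠ 0 := (Metric.measure_ball_pos _ _ one_pos).ne'
  have hvdt : vd ≠ ⊤ := measure_ball_lt_top.ne
  have hk0 : ((k + 1 : ℕ) : ENNReal) ≠ 0 := by simp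
  have hkt : ((k + 1 : ℕ) : ENNReal) ≠ ⊤ := ENNReal.natCast_ne_top _
  rw [unifSphere, Measure.smul_apply, smul_eq_mul, Measure.toSphere_apply_univ,
    Measure.toSphere_apply' _ (measurableSet_sphere_slab u s), finrank_euclideanSpace_fin,
    ← ENNReal.div_eq_inv_mul]
  apply ENNReal.div_le_of_le_mul'
  rw [mul_assoc]
  gcongr
  -- The sphere measure of a set is k + 1 times the volume of the cone over it; scaling by r < 1
  -- keeps that cone in the slab.
  calc _ ≤ volume {x : EuclideanSpace ℝ (Fin (k + 1)) | ‖x‖ < 1 ∧ |inner ℝ x u| < s} := by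
        apply measure_mono
        rintro x ⟨r, ⟨hr0, hr1⟩, y, ⟨z, hz, rfl⟩, rfl⟩
        have hz1 : ‖(z : EuclideanSpace ℝ (Fin (k + 1)))‖ = 1 := by simp
        have hz' : |inner ℝ (z : EuclideanSpace ℝ (Fin (k + 1))) u| < s := hz
        refine ⟨?_, ?_⟩
        · simp only [norm_smul, hz1, Real.norm_eq_abs, abs_of_pos hr0, mul_one]
          exact hr1
        · simp only [real_inner_smul_left, abs_mul, abs_of_pos hr0]
          nlinarith [abs_nonneg (inner ℝ (z : EuclideanSpace ℝ (Fin (k + 1))) u)]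
    _ ≤ _ := volume_slab_inter_ball_le u hu s
    _ ≤ ENNReal.ofReal (2 * s) * (ENNReal.ofReal (√((k + 1 : ℕ) / Real.pi)) * vd) := by
        gcongr
        exact volume_ball_le_volume_ball_succ k
    _ = _ := by
        rw [← mul_assoc, ← ENNReal.ofReal_mul (by positivity), mul_comm]

/-! ### Nets on the unit sphere -/

section Net

variable {E : Type*} [NormedAddCommGroup E] [NormedSpace ℝ E] [FiniteDimensional ℝ E]

/-- Balls of radius ε/2 about the points are disjoint and lie in the ball of radius 1 + ε/2; compare
volumes. -/
theorem card_le_of_separated_sphere {ε : ℝ} (hε : 0 < ε) (s : Finset E)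
    (hs : ∀ c ∈ s, ‖c‖ = 1) (h : ∀ c ∈ s, ∀ d ∈ s, c ≠ d → ε ≤ ‖c - d‖) :
    (s.card : ℝ) ≤ (2 / ε + 1) ^ Module.finrank ℝ E := by
  borelize E
  let μ : Measure E := Measure.addHaar
  have hε2 : 0 < ε / 2 := by positivity
  have hρ : 0 < ε / 2 + 1 := by positivity
  have D : Set.Pairwise (s : Set E) (Function.onFun Disjoint fun c => Metric.ball c (ε / 2)) := by
    rintro c hc d hd hcd
    apply Metric.ball_disjoint_ball
    rw [dist_eq_norm, add_halves]
    exact h c hc d hd hcd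
  have hsub : (⋃ c ∈ s, Metric.ball c (ε / 2)) ⊆ Metric.ball (0 : E) (ε / 2 + 1) := by
    refine Set.iUnion₂_subset fun x hx => Metric.ball_subset_ball' ?_
    rw [dist_zero_right, hs x hx]
  have I : (s.card : ENNReal) * ENNReal.ofReal ((ε / 2) ^ Module.finrank ℝ E) *
      μ (Metric.ball 0 1) ≤
      ENNReal.ofReal ((ε / 2 + 1) ^ Module.finrank ℝ E) * μ (Metric.ball 0 1) :=
    calc _ = μ (⋃ c ∈ s, Metric.ball c (ε / 2)) := by
          rw [measure_biUnion_finset D fun c _ => measurableSet_ball]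
          simp only [μ.addHaar_ball_of_pos _ hε2, Finset.sum_const, nsmul_eq_mul, mul_assoc]
      _ ≤ _ := measure_mono hsub
      _ = _ := by simp only [μ.addHaar_ball_of_pos _ hρ]
  have J := (ENNReal.mul_le_mul_iff_left (Metric.measure_ball_pos μ _ zero_lt_one).ne'
    measure_ball_lt_top.ne).1 I
  have K := ENNReal.toReal_le_of_le_ofReal (pow_nonneg hρ.le _) J
  rw [ENNReal.toReal_mul, ENNReal.toReal_natCast, ENNReal.toReal_ofReal (by positivity),
    ← le_div_iff₀ (by positivity), ← div_pow] at K
  rwa [add_div, div_self hε2.ne', one_div_div, add_comm] at K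

/-- The unit sphere has an `ε`-net of cardinality at most `(2 / ε + 1) ^ dim E`. -/
theorem exists_net_sphere (E : Type*) [NormedAddCommGroup E] [NormedSpace ℝ E]
    [FiniteDimensional ℝ E] {ε : ℝ} (hε : 0 < ε) :
    ∃ s : Finset E, (∀ c ∈ s, ‖c‖ = 1) ∧ (s.card : ℝ) ≤ (2 / ε + 1) ^ Module.finrank ℝ E ∧
      ∀ u : E, ‖u‖ = 1 → ∃ c ∈ s, ‖u - c‖ < ε := by
  classical
  let T : Set (Finset E) :=
    {s | (∀ c ∈ s, ‖c‖ = 1) ∧ ∀ c ∈ s, ∀ d ∈ s, c ≠ d → ε ≤ ‖c - d‖}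
  have hbdd : BddAbove (Finset.card '' T) := by
    refine ⟨⌊(2 / ε + 1) ^ Module.finrank ℝ E⌋₊, ?_⟩
    rintro _ ⟨s, hs, rfl⟩
    exact Nat.le_floor (card_le_of_separated_sphere hε s hs.1 hs.2)
  -- A separated set of maximal cardinality is a net: an uncovered point could be added to it.
  obtain ⟨s, hs, hmax⟩ := Nat.sSup_mem (s := Finset.card '' T) ⟨0, ∅, by simp [T], rfl⟩ hbdd
  refine ⟨s, hs.1, card_le_of_separated_sphere hε s hs.1 hs.2, fun u hu => ?_⟩
  by_contra! hc
  have hus : u ∉ s := fun hmem => by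
    have := hc u hmem
    rw [sub_self, norm_zero] at this
    exact absurd this (not_le.mpr hε)
  have hT : insert u s ∈ T := by
    refine ⟨?_, ?_⟩
    · intro c hcs
      rcases Finset.mem_insert.mp hcs with rfl | hcs
      exacts [hu, hs.1 c hcs]
    · intro c hcs d hds hne
      rcases Finset.mem_insert.mp hcs with rfl | hcs' <;>
        rcases Finset.mem_insert.mp hds with rfl | hds'
      · exact absurd rfl hne
      · exact hc d hds'
      · rw [norm_sub_rev]; exact hc c hcs'
      · exact hs.2 c hcs' d hds' hne
  have := le_csSup hbdd ⟨_, hT, rfl⟩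
  rw [← hmax, Finset.card_insert_of_notMem hus] at this
  omega

end Net

/-! ### Chernoff bound for independent trials -/

section Chernoff

variable {Ω S : Type*} [MeasurableSpace Ω] [MeasurableSpace S]

theorem mgf_indicator_one (P : Measure Ω) [IsProbabilityMeasure P] {A : Set Ω}
    (hA : NullMeasurableSet A P) (t : ℝ) :
    mgf (A.indicator 1) P t = 1 + P.real A * (Real.exp t - 1) := by
  have h : (fun ω => Real.exp (t * A.indicator (1 : Ω → ℝ) ω)) =
      fun ω => 1 + A.indicator (fun _ => Real.exp t - 1) ω := by
    funext ω
    by_cases hω : ω ∈ A <;> simp [hω]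
  have hint : Integrable (A.indicator (fun _ => Real.exp t - 1)) P :=
    (integrable_const _).indicator₀ hA
  rw [mgf, h, integral_add (integrable_const _) hint, integral_indicator₀ hA]
  simp

/-- A Chernoff bound for the number of successes among independent trials. -/
theorem measureReal_card_ge_le {n : ℕ} (P : Measure Ω) [IsProbabilityMeasure P]
    (ν : Measure S) (z : Fin n → Ω → S) (hindep : iIndepFun z P) (hlaw : ∀ i, HasLaw (z i) ν P)
    {A : Set S} (hA : MeasurableSet A) {p : ℝ} (hp : ν.real A ≤ p) (r : ℝ) :
    P.real {ω | r ≤ ({i | z i ω ∈ A}.ncard : ℝ)} ≤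
      Real.exp (n * (p * (Real.exp 1 - 1)) - r) := by
  classical
  set X : Fin n → Ω → ℝ := fun i => A.indicator 1 ∘ z i with hX
  have hXm : Measurable (A.indicator (1 : S → ℝ)) := measurable_const.indicator hA
  have hXi : ∀ i, AEMeasurable (X i) P := fun i => hXm.comp_aemeasurable (hlaw i).aemeasurable
  have hXind : iIndepFun X P := hindep.comp (fun _ => A.indicator 1) (fun _ => hXm)
  have hsum : ∀ ω, (∑ i, X i) ω = ({i | z i ω ∈ A}.ncard : ℝ) := by
    intro ω
    rw [Finset.sum_apply, Set.ncard_eq_toFinset_card']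
    simp [hX, Set.indicator_apply, Finset.sum_boole]
  have hmgf : ∀ i, mgf (X i) P 1 ≤ Real.exp (p * (Real.exp 1 - 1)) := by
    intro i
    have e : X i = (z i ⁻¹' A).indicator 1 := by
      funext ω
      simp [hX, Set.indicator_apply]
    have hreal : P.real (z i ⁻¹' A) = ν.real A := by
      rw [← (hlaw i).map_eq, map_measureReal_apply_of_aemeasurable (hlaw i).aemeasurable hA]
    rw [e, mgf_indicator_one P ((hlaw i).aemeasurable.nullMeasurable hA), hreal]
    have h1 : 0 ≤ Real.exp 1 - 1 := by
      have := Real.add_one_le_exp (1 : ℝ)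
      linarith
    calc _ ≤ p * (Real.exp 1 - 1) + 1 := by
          have := mul_le_mul_of_nonneg_right hp h1
          linarith
      _ ≤ _ := Real.add_one_le_exp _
  have hint : Integrable (fun ω => Real.exp (1 * (∑ i, X i) ω)) P := by
    refine Integrable.of_bound (C := Real.exp n) ?_ (ae_of_all _ fun ω => ?_)
    · have : AEMeasurable (∑ i, X i) P := Finset.aemeasurable_sum _ fun i _ => hXi i
      exact (Real.measurable_exp.comp_aemeasurable (this.const_mul 1)).aestronglyMeasurable
    · rw [Real.norm_eq_abs, Real.abs_exp, one_mul, hsum]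
      apply Real.exp_le_exp.mpr
      have := Set.ncard_le_card {i | z i ω ∈ A}
      rw [Nat.card_fin] at this
      exact_mod_cast this
  -- The exponential Markov inequality at parameter 1; no optimisation is needed.
  have h := measure_ge_le_exp_mul_mgf r zero_le_one hint
  simp only [hsum] at h
  refine h.trans ?_
  rw [hXind.mgf_sum₀ hXi]
  calc _ ≤ Real.exp (-1 * r) * ∏ _i : Fin n, Real.exp (p * (Real.exp 1 - 1)) := by
        gcongr with i
        · exact fun i _ => mgf_nonneg
        · exact hmgf i
    _ = _ := by
        rw [Finset.prod_const, Finset.card_univ, Fintype.card_fin, ← Real.exp_nat_mul,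
          ← Real.exp_add]
        congr 1
        ring

end Chernoff

/-! ### Deterministic Lipschitz bounds -/

section Orbit

variable {V : Type*} [NormedAddCommGroup V] [InnerProductSpace ℝ V]

theorem orbitMk_eq_iff {G : Subgroup (V ≃ₗᵢ[ℝ] V)} {x y : V} :
    orbitMk G x = orbitMk G y ↔ ∃ g ∈ G, g x = y :=
  Quotient.eq (r := orbitSetoid G)

theorem orbitMk_apply (G : Subgroup (V ≃ₗᵢ[ℝ] V)) (g : G) (x : V) :
    orbitMk G ((g : V ≃ₗᵢ[ℝ] V) x) = orbitMk G x :=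
  (orbitMk_eq_iff.mpr ⟨(g : V ≃ₗᵢ[ℝ] V), g.2, rfl⟩).symm

theorem orbitMk_surjective (G : Subgroup (V ≃ₗᵢ[ℝ] V)) : Function.Surjective (orbitMk G) :=
  Quotient.mk_surjective

theorem inner_inv_apply (g : V ≃ₗᵢ[ℝ] V) (x y : V) : inner ℝ (g x) y = inner ℝ x (g⁻¹ y) := by
  rw [← g.inner_map_map x (g⁻¹ y)]
  congr 1
  exact (g.apply_symm_apply y).symm

theorem maxFilter_mk (G : Subgroup (V ≃ₗᵢ[ℝ] V)) (z x : V) :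
    maxFilter G (orbitMk G z) (orbitMk G x) = ⨆ g : G, inner ℝ z ((g : V ≃ₗᵢ[ℝ] V) x) := by
  rw [maxFilter, iSup]
  congr 1
  ext r
  constructor
  · rintro ⟨p, q, hp, hq, rfl⟩
    obtain ⟨g, hg, rfl⟩ := orbitMk_eq_iff.mp hp.symm
    obtain ⟨h, hh, rfl⟩ := orbitMk_eq_iff.mp hq.symm
    exact ⟨⟨g⁻¹ * h, G.mul_mem (G.inv_mem hg) hh⟩, (inner_inv_apply g z (h x)).symm⟩
  · rintro ⟨g, rfl⟩
    exact ⟨z, (g : V ≃ₗᵢ[ℝ] V) x, rfl, orbitMk_apply G g x, rfl⟩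

variable (G : Subgroup (V ≃ₗᵢ[ℝ] V)) [Finite G]

theorem exists_maxFilter_mk_eq (z x : V) :
    ∃ g : G, maxFilter G (orbitMk G z) (orbitMk G x) = inner ℝ z ((g : V ≃ₗᵢ[ℝ] V) x) := by
  obtain ⟨g, hg⟩ := exists_eq_ciSup_of_finite (f := fun g : G => inner ℝ z ((g : V ≃ₗᵢ[ℝ] V) x))
  exact ⟨g, by rw [maxFilter_mk, hg]⟩

theorem inner_le_maxFilter_mk (z x : V) :
    inner ℝ z x ≤ maxFilter G (orbitMk G z) (orbitMk G x) := by
  rw [maxFilter_mk]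
  exact le_ciSup (f := fun g : G => inner ℝ z ((g : V ≃ₗᵢ[ℝ] V) x))
    (Set.finite_range _).bddAbove 1

theorem continuous_maxFilter_mk (a : OrbitSpace G) :
    Continuous fun z : V => maxFilter G (orbitMk G z) a := by
  obtain ⟨x, rfl⟩ := orbitMk_surjective G a
  have := Fintype.ofFinite G
  simp only [maxFilter_mk, ← Finset.sup'_univ_eq_ciSup]
  exact Continuous.finset_sup'_apply _ fun g _ => by fun_prop

theorem maxFilter_le_add (z p q : V) :
    maxFilter G (orbitMk G z) (orbitMk G p) ≤
      maxFilter G (orbitMk G z) (orbitMk G q) + ‖z‖ * ‖p - q‖ := by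
  obtain ⟨g, hg⟩ := exists_maxFilter_mk_eq G z p
  have hq : orbitMk G ((g : V ≃ₗᵢ[ℝ] V) q) = orbitMk G q := orbitMk_apply G g q
  have h1 := inner_le_maxFilter_mk G z ((g : V ≃ₗᵢ[ℝ] V) q)
  have h2 := real_inner_le_norm z ((g : V ≃ₗᵢ[ℝ] V) (p - q))
  rw [LinearIsometryEquiv.norm_map, map_sub, inner_sub_right] at h2
  rw [hq] at h1
  rw [hg]
  linarith

theorem abs_maxFilter_sub_le (z p q : V) :
    |maxFilter G (orbitMk G z) (orbitMk G p) - maxFilter G (orbitMk G z) (orbitMk G q)| ≤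
      ‖z‖ * ‖p - q‖ := by
  rw [abs_sub_le_iff]
  constructor
  · linarith [maxFilter_le_add G z p q]
  · rw [norm_sub_rev]
    linarith [maxFilter_le_add G z q p]

theorem quotientDist_mk_le (G : Subgroup (V ≃ₗᵢ[ℝ] V)) (g h : G) (x y : V) :
    quotientDist G (orbitMk G x) (orbitMk G y) ≤
      ‖(g : V ≃ₗᵢ[ℝ] V) x - (h : V ≃ₗᵢ[ℝ] V) y‖ := by
  apply csInf_le
  · refine ⟨0, ?_⟩
    rintro _ ⟨p, q, -, -, rfl⟩
    exact norm_nonneg _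
  · exact ⟨_, _, orbitMk_apply G g x, orbitMk_apply G h y, rfl⟩

/-- Unit templates give a max filter bank with upper Lipschitz bound `√n`. -/
theorem hasUpperLipschitzBound_maxFilterBank {n : ℕ} (z : Fin n → V) (hz : ∀ i, ‖z i‖ = 1) :
    HasUpperLipschitzBound G (maxFilterBank G z) (√n) := by
  intro a b
  rcases Nat.eq_zero_or_pos n with rfl | hn
  · simp [EuclideanSpace.norm_eq]
  have hn' : 0 < √(n : ℝ) := Real.sqrt_pos.mpr (by exact_mod_cast hn)
  rw [← div_le_iff₀' hn']
  obtain ⟨x, rfl⟩ := orbitMk_surjective G a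
  obtain ⟨y, rfl⟩ := orbitMk_surjective G b
  refine le_csInf ⟨_, x, y, rfl, rfl, rfl⟩ ?_
  rintro _ ⟨p, q, hp, hq, rfl⟩
  rw [div_le_iff₀' hn', ← hp, ← hq, EuclideanSpace.norm_eq,
    ← Real.sqrt_sq (norm_nonneg (p - q)), ← Real.sqrt_mul (by positivity)]
  apply Real.sqrt_le_sqrt
  calc _ ≤ ∑ _i : Fin n, ‖p - q‖ ^ 2 := by
        refine Finset.sum_le_sum fun i _ => ?_
        have := abs_maxFilter_sub_le G (z i) p q
        rw [hz i, one_mul] at this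
        gcongr
        exact this
    _ = _ := by simp

/-- If every unit vector is nearly orthogonal to fewer than a fraction `1 / |G|²` of the templates,
then the max filter bank has a lower Lipschitz bound. -/
theorem hasLowerLipschitzBound_maxFilterBank {n : ℕ} (z : Fin n → V) {δ : ℝ} (hδ : 0 ≤ δ)
    (h : ∀ u : V, ‖u‖ = 1 →
      ({i | |inner ℝ (z i) u| < δ}.ncard : ℝ) < n / (Nat.card G : ℝ) ^ 2) :
    HasLowerLipschitzBound G (maxFilterBank G z) δ := by
  classical
  have := Fintype.ofFinite G
  intro a b
  obtain ⟨x, rfl⟩ := orbitMk_surjective G a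
  obtain ⟨y, rfl⟩ := orbitMk_surjective G b
  choose g hg using fun i => exists_maxFilter_mk_eq G (z i) x
  choose k hk using fun i => exists_maxFilter_mk_eq G (z i) y
  -- Pigeonhole over the pairs of maximising group elements.
  obtain ⟨⟨g₀, k₀⟩, -, hfib⟩ := Finset.exists_le_card_fiber_of_nsmul_le_card_of_maps_to
    (M := ℝ) (s := (Finset.univ : Finset (Fin n))) (t := (Finset.univ : Finset (G × G)))
    (f := fun i => (g i, k i)) (b := n / (Nat.card G : ℝ) ^ 2) (by simp) Finset.univ_nonempty (by
      have : (Nat.card G : ℝ) ≠ 0 := by exact_mod_cast Nat.card_pos.ne'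
      rw [Finset.card_univ, Finset.card_univ, Fintype.card_prod, Fintype.card_fin, nsmul_eq_mul,
        ← Nat.card_eq_fintype_card]
      push_cast
      apply le_of_eq
      field_simp)
  set w := (g₀ : V ≃ₗᵢ[ℝ] V) x - (k₀ : V ≃ₗᵢ[ℝ] V) y with hw
  have hdist : quotientDist G (orbitMk G x) (orbitMk G y) ≤ ‖w‖ := quotientDist_mk_le G g₀ k₀ x y
  rcases eq_or_ne w 0 with hw0 | hw0
  · rw [hw0, norm_zero] at hdist
    exact (mul_nonpos_of_nonneg_of_nonpos hδ hdist).trans (norm_nonneg _)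
  have hw' : 0 < ‖w‖ := norm_pos_iff.mpr hw0
  have hu := h (‖w‖⁻¹ • w) (by
    rw [norm_smul, norm_inv, norm_norm, inv_mul_cancel₀ hw'.ne'])
  obtain ⟨i, hi1, hi2⟩ : ∃ i, (g i, k i) = (g₀, k₀) ∧ δ ≤ |inner ℝ (z i) (‖w‖⁻¹ • w)| := by
    by_contra! hcon
    refine absurd (hfib.trans ?_) (not_le.mpr hu)
    rw [Set.ncard_eq_toFinset_card']
    norm_cast
    apply Finset.card_le_card
    intro i hi
    simpa using hcon i (Finset.mem_filter.mp hi).2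
  rw [Prod.mk.injEq] at hi1
  rw [inner_smul_right, abs_mul, abs_inv, abs_norm, ← div_eq_inv_mul, le_div_iff₀ hw'] at hi2
  calc _ ≤ δ * ‖w‖ := by gcongr
    _ ≤ |inner ℝ (z i) w| := hi2
    _ = ‖(maxFilterBank G z (orbitMk G x) - maxFilterBank G z (orbitMk G y)) i‖ := by
        rw [hw, inner_sub_right, ← hi1.1, ← hi1.2, ← hg i, ← hk i]
        rfl
    _ ≤ _ := PiLp.norm_apply_le _ i

/-- Gives measurability of the event, an uncountable intersection over pairs of orbits. -/
theorem isClosed_setOf_hasLowerLipschitzBound (n : ℕ) (δ : ℝ) :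
    IsClosed {z : Fin n → V | HasLowerLipschitzBound G (maxFilterBank G z) δ} := by
  simp only [HasLowerLipschitzBound, Set.ofPred_forall]
  refine isClosed_iInter fun a => isClosed_iInter fun b => isClosed_le continuous_const ?_
  have hc : ∀ a : OrbitSpace G, Continuous fun z : Fin n → V => maxFilterBank G z a := fun a =>
    (PiLp.continuous_toLp 2 _).comp
      (continuous_pi fun i => (continuous_maxFilter_mk G a).comp (continuous_apply i))
  exact ((hc a).sub (hc b)).norm

end Orbit

/-! ### Union bound and choice of constants -/

/-- With high probability, every unit vector is nearly orthogonal to only a small fraction of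
independent uniform templates. -/
theorem measureReal_exists_card_slab_ge_le {d n : ℕ} (hd : 0 < d) {δ M : ℝ} (hδ : 0 < δ)
    (hM : 0 < M) (hslab : 4 * δ * √(d / Real.pi) ≤ 1 / (4 * M))
    (hn : 12 * M * d * Real.log (2 / δ + 1) ≤ n)
    {Ω : Type*} [MeasurableSpace Ω] (P : Measure Ω) [IsProbabilityMeasure P]
    (z : Fin n → Ω → Metric.sphere (0 : EuclideanSpace ℝ (Fin d)) 1)
    (hindep : iIndepFun z P) (hlaw : ∀ i, HasLaw (z i) (unifSphere d) P) :
    P.real {ω | ∃ u : EuclideanSpace ℝ (Fin d), ‖u‖ = 1 ∧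
      n / M ≤ ({i | |inner ℝ (z i ω : EuclideanSpace ℝ (Fin d)) u| < δ}.ncard : ℝ)} ≤
      Real.exp (-(n : ℝ) / (12 * M)) := by
  obtain ⟨N, hN1, hNcard, hNnet⟩ := exists_net_sphere (EuclideanSpace ℝ (Fin d)) hδ
  rw [finrank_euclideanSpace_fin] at hNcard
  let A : EuclideanSpace ℝ (Fin d) → Set (Metric.sphere (0 : EuclideanSpace ℝ (Fin d)) 1) :=
    fun c => {z | |inner ℝ (z : EuclideanSpace ℝ (Fin d)) c| < 2 * δ}
  have hA : ∀ c ∈ N, (unifSphere d).real (A c) ≤ 1 / (4 * M) := fun c hc => by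
    refine ENNReal.toReal_le_of_le_ofReal (by positivity) ?_
    refine (unifSphere_slab_le hd c (hN1 c hc) (by positivity)).trans (ENNReal.ofReal_le_ofReal ?_)
    linarith
  have hbad : ∀ c ∈ N, P.real {ω | n / M ≤ ({i | z i ω ∈ A c}.ncard : ℝ)} ≤
      Real.exp (-(n : ℝ) / (6 * M)) := fun c hc => by
    refine (measureReal_card_ge_le P _ z hindep hlaw (measurableSet_sphere_slab c _) (hA c hc)
      _).trans (Real.exp_le_exp.mpr ?_)
    have he : Real.exp 1 - 1 ≤ 2 := by linarith [Real.exp_one_lt_d9]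
    have hnM : 0 ≤ n / M := by positivity
    -- The bracket is at most -1/2; the weaker -1/6 already suffices.
    calc _ = n / M * ((Real.exp 1 - 1) / 4 - 1) := by field_simp
      _ ≤ n / M * (-(1 / 6)) := by gcongr; linarith
      _ = _ := by field_simp
  calc _ ≤ P.real (⋃ c ∈ N, {ω | n / M ≤ ({i | z i ω ∈ A c}.ncard : ℝ)}) := by
        refine measureReal_mono ?_ (measure_ne_top _ _)
        rintro ω ⟨u, hu, hcard⟩
        obtain ⟨c, hc, huc⟩ := hNnet u hu
        refine Set.mem_iUnion₂.mpr ⟨c, hc, hcard.trans ?_⟩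
        norm_cast
        refine Set.ncard_le_ncard (fun i hi => ?_) (Set.toFinite _)
        have hi' : |inner ℝ (z i ω : EuclideanSpace ℝ (Fin d)) u| < δ := hi
        -- Moving u to a net point within δ changes the inner product with a unit vector by less
        -- than δ.
        have h1 := abs_real_inner_le_norm (z i ω : EuclideanSpace ℝ (Fin d)) (u - c)
        rw [norm_eq_of_mem_sphere, one_mul, inner_sub_right, abs_sub_comm] at h1
        have h2 := abs_sub_abs_le_abs_sub (inner ℝ (z i ω : EuclideanSpace ℝ (Fin d)) c)
          (inner ℝ (z i ω : EuclideanSpace ℝ (Fin d)) u)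
        change |inner ℝ (z i ω : EuclideanSpace ℝ (Fin d)) c| < 2 * δ
        linarith
    _ ≤ ∑ c ∈ N, P.real {ω | n / M ≤ ({i | z i ω ∈ A c}.ncard : ℝ)} :=
        measureReal_biUnion_finset_le _ _
    _ ≤ ∑ _c ∈ N, Real.exp (-(n : ℝ) / (6 * M)) := Finset.sum_le_sum hbad
    _ = N.card * Real.exp (-(n : ℝ) / (6 * M)) := by rw [Finset.sum_const, nsmul_eq_mul]
    _ ≤ Real.exp (d * Real.log (2 / δ + 1)) * Real.exp (-(n : ℝ) / (6 * M)) := by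
        gcongr
        rwa [Real.exp_nat_mul, Real.exp_log (by positivity)]
    -- The net costs half of the exponent n/(6M).
    _ ≤ Real.exp (n / (12 * M)) * Real.exp (-(n : ℝ) / (6 * M)) := by
        gcongr
        rw [le_div_iff₀ (by positivity)]
        linarith
    _ = _ := by
        rw [← Real.exp_add]
        congr 1
        field_simp
        ring

/-- Only d/L ≤ 1/2 matters, so the logarithm in δ is slack; 2 · 128 = 16² gives the constant. -/
theorem four_mul_mul_sqrt_div_pi_le {d m δ L : ℝ} (hd : 0 < d) (hm : 0 < m) (hL : 2 * d ≤ L)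
    (hδ : δ = √(Real.pi / (128 * m ^ 4) * (1 / L))) :
    4 * δ * √(d / Real.pi) ≤ 1 / (4 * m ^ 2) := by
  have hL0 : 0 < L := by linarith
  rw [hδ, mul_assoc, ← Real.sqrt_mul (by positivity)]
  have e : Real.pi / (128 * m ^ 4) * (1 / L) * (d / Real.pi) = d / L * (1 / (128 * m ^ 4)) := by
    field_simp
  have h : √(d / L * (1 / (128 * m ^ 4))) ≤ 1 / (16 * m ^ 2) := by
    apply Real.sqrt_le_iff.mpr ⟨by positivity, ?_⟩
    calc _ ≤ 1 / 2 * (1 / (128 * m ^ 4)) := by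
          refine mul_le_mul_of_nonneg_right ?_ (by positivity)
          rw [div_le_iff₀ hL0]
          linarith
      _ = _ := by field_simp; norm_num
  rw [e]
  calc _ ≤ 4 * (1 / (16 * m ^ 2)) := by gcongr
    _ = _ := by field_simp; norm_num

end MaxFiltering

/-! ### The main theorem -/

theorem mainTheorem1 (d m n : ℕ) (hd : 0 < d)
    (G : Subgroup (EuclideanSpace ℝ (Fin d) ≃ₗᵢ[ℝ] EuclideanSpace ℝ (Fin d)))
    [Finite G] (hm : Nat.card G = m)
    (δ : ℝ)
    (hδ : δ = Real.sqrt (Real.pi / (128 * (m : ℝ) ^ 4) *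
      (1 / (2 * (d : ℝ) + 3 * Real.log (4 * (m : ℝ) ^ 2)))))
    (hn : 12 * (m : ℝ) ^ 2 * (d : ℝ) * Real.log (2 / δ + 1) ≤ (n : ℝ))
    {Ω : Type*} [MeasurableSpace Ω] (P : Measure Ω) [IsProbabilityMeasure P]
    (z : Fin n → Ω → Metric.sphere (0 : EuclideanSpace ℝ (Fin d)) 1)
    (hindep : iIndepFun z P)
    (hlaw : ∀ i, HasLaw (z i) (MaxFiltering.unifSphere d) P) :
    NullMeasurableSet {ω | MaxFiltering.HasLowerLipschitzBound G
        (MaxFiltering.maxFilterBank G (fun i => (z i ω : EuclideanSpace ℝ (Fin d)))) δ ∧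
      MaxFiltering.HasUpperLipschitzBound G
        (MaxFiltering.maxFilterBank G (fun i => (z i ω : EuclideanSpace ℝ (Fin d))))
        (Real.sqrt n)} P ∧
    1 - Real.exp (-(n : ℝ) / (12 * (m : ℝ) ^ 2)) ≤
      P.real {ω | MaxFiltering.HasLowerLipschitzBound G
          (MaxFiltering.maxFilterBank G (fun i => (z i ω : EuclideanSpace ℝ (Fin d)))) δ ∧
        MaxFiltering.HasUpperLipschitzBound G
          (MaxFiltering.maxFilterBank G (fun i => (z i ω : EuclideanSpace ℝ (Fin d))))
          (Real.sqrt n)} := by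
  have hm0 : (0 : ℝ) < m := by
    rw [← hm]
    exact_mod_cast Nat.card_pos
  have hm1 : (1 : ℝ) ≤ m := by exact_mod_cast hm0
  have hd0 : (0 : ℝ) < d := by exact_mod_cast hd
  have hlog : 0 ≤ Real.log (4 * (m : ℝ) ^ 2) := Real.log_nonneg (by nlinarith)
  have hδ0 : 0 < δ := by
    rw [hδ]
    positivity
  have hslab := MaxFiltering.four_mul_mul_sqrt_div_pi_le hd0 hm0 (by linarith) hδ
  have hbound := MaxFiltering.measureReal_exists_card_slab_ge_le hd hδ0 (M := (m : ℝ) ^ 2)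
    (by positivity) hslab hn P z hindep hlaw
  have hupper : ∀ ω, MaxFiltering.HasUpperLipschitzBound G
      (MaxFiltering.maxFilterBank G (fun i => (z i ω : EuclideanSpace ℝ (Fin d)))) (√n) :=
    fun ω => MaxFiltering.hasUpperLipschitzBound_maxFilterBank G _ (by simp)
  simp only [hupper, and_true]
  have hmeas : NullMeasurableSet {ω | MaxFiltering.HasLowerLipschitzBound G
      (MaxFiltering.maxFilterBank G (fun i => (z i ω : EuclideanSpace ℝ (Fin d)))) δ} P := by
    have hz : AEMeasurable (fun ω i => (z i ω : EuclideanSpace ℝ (Fin d))) P :=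
      aemeasurable_pi_lambda _ fun i =>
        measurable_subtype_coe.comp_aemeasurable (hlaw i).aemeasurable
    exact hz.nullMeasurable
      (MaxFiltering.isClosed_setOf_hasLowerLipschitzBound G n δ).measurableSet
  refine ⟨hmeas, ?_⟩
  have hcompl := probReal_compl_eq_one_sub₀ hmeas
  have hsub : {ω | MaxFiltering.HasLowerLipschitzBound G
      (MaxFiltering.maxFilterBank G (fun i => (z i ω : EuclideanSpace ℝ (Fin d)))) δ}ᶜ ⊆
      {ω | ∃ u : EuclideanSpace ℝ (Fin d), ‖u‖ = 1 ∧ n / (m : ℝ) ^ 2 ≤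
        ({i | |inner ℝ (z i ω : EuclideanSpace ℝ (Fin d)) u| < δ}.ncard : ℝ)} := by
    intro ω hω
    by_contra hcon
    refine hω (MaxFiltering.hasLowerLipschitzBound_maxFilterBank G _ hδ0.le fun u hu => ?_)
    by_contra hlt
    exact hcon ⟨u, hu, by rw [← hm]; exact not_lt.mp hlt⟩
  have := measureReal_mono (μ := P) hsub (measure_ne_top _ _)
  linarith
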